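/- \textbf{Setting.} Let $\mathcal H,\mathcal V$ be real Hilbert spaces, $\mathcal V$ densely and continuously embedded in $\mathcal H$; identify $\mathcal H$ with its dual, so that $\mathcal V\hookrightarrow\mathcal H=\mathcal H'\hookrightarrow\mathcal V'$. Let $U=\prod_{j=1}^J U_j$, where $U_j$ is a closed subspace of $L^2(X_j,\mu_j)^{N_j}$, $X_j$ is a metric space and $\mu_j$ is a finite measure on a $\sigma$-algebra containing the Borel sets of $X_j$. Let $I_U:\mathcal V\to U$ be the canonical bounded linear map, also viewed as the operator $\mathcal V\to\mathcal V'$, $\langle I_Uu,v\rangle=(I_Uu,I_Uv)_U$. Let $\alpha_j\in C([0,\infty)\times X_j;(0,\infty))$ be such that for each $T>0$ there is $\kappa(T)>0$ with $|\alpha_j(t,x)-\alpha_j(s,x)|\le\kappa(T)|t-s|$ for all $s,t\in[0,T]$, $x\in X_j$. Let $g_j:\mathbb R^{N_j}\to\mathbb R^{N_j}$ be continuous with $(g_j(x)-g_j(y))\cdot(x-y)\ge 0$, $g_j(0)=0$ and $|g_j(x)|\le M(1+|x|)$ for some $M>0$. Define $B(t)u\in\mathcal V'$ by $$\langle B(t)u,v\rangle=\sum_{j=1}^J\int_{X_j}\alpha_j(t,x_j)\,g_j((I_Uu)_j(x_j))\cdot(I_Uv)_j(x_j)\,d\mu_j(x_j),\qquad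 v\in\mathcal V$$ (whenever these integrals converge for all $v\in\mathcal V$ and define an element of $\mathcal V'$). Let $A_1:\mathcal V\to\mathcal V'$ be bounded and linear with $\langle A_1u,u\rangle=0$ for all $u\in\mathcal V$, and let $\mathcal A_B(t)=A_1+B(t)$ with domain $D(\mathcal A_B(t))=\{v\in\mathcal V: (A_1+B(t))v\in\mathcal H\}$. A solution of $$x'(t)+A_1x(t)+B(t)x(t)=0\ \text{ in }\mathcal H,\ t\ge0,\qquad x(0)=x_0,$$ means a function $x\in C([0,\infty),\mathcal H)$ with $x(0)=x_0$, $x(t)\in D(\mathcal A_B(t))$ for all $t\ge0$, such that outside a countable set of times $x'(t)=-\mathcal A_B(t)x(t)$ exists in $\mathcal H$ and is continuous. Its energy is $\mathcal E(t)=\frac12\|x(t)\|_{\mathcal H}^2$. \textbf{Statement.} Let $C,\omega>0$. There is $T_0>0$ such that for every $T\ge T_0$ there is a constant $D>1$, depending only on $T$, $C$ and $\omega$, with the following property. In any setting as above, suppose that $A_1-I_U$ (with domain $\{v\in\mathcal V:(A_1-I_U)v\in\mathcal H\}$) generates a $C_0$-semigroup of contractions in $\mathcal H$, and that $-A_1-I_U$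 (with the analogous domain) generates a $C_0$-semigroup of contractions $(S(t))_{t\ge0}$ in $\mathcal H$ such that $\|S(t)x_0\|_{\mathcal H}\le Ce^{-\omega t}\|x_0\|_{\mathcal H}$ for all $t\ge0$ and $x_0\in\mathcal H$. Then every solution $x$ satisfies $$\mathcal E(T)\le D\sum_{j=1}^J\int_0^T\int_{X_j}\Big(|(I_Ux(t))_j|^2+\alpha_j(t,\cdot)^2\,|g_j((I_Ux(t))_j)|^2\Big)\,d\mu_j\,dt$$ and, for every $n\in\mathbb N$ (including $n=0$), $$\mathcal E((n+1)T)\le D\sum_{j=1}^J\int_{nT}^{(n+1)T}\int_{X_j}\Big(|(I_Ux(t))_j|^2+\alpha_j(t,\cdot)^2\,|g_j((I_Ux(t))_j)|^2\Big)\,d\mu_j\,dt,$$ where the integrals of nonnegative functions take values in $[0,\infty]$. -/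

import Mathlib

open Set Filter Topology MeasureTheory
open scoped ENNReal RealInnerProductSpace

noncomputable section

/-- A strongly continuous semigroup of bounded linear operators `S t`, `t ≥ 0`, on a real Banach
space.  Only the values at `t ≥ 0` are meaningful. -/
structure C0Semigroup (H : Type*) [NormedAddCommGroup H] [NormedSpace ℝ H] where
  /-- the operators of the semigroup -/
  toFun : ℝ → H →L[ℝ] H
  map_zero : toFun 0 = ContinuousLinearMap.id ℝ H
  map_add : ∀ s t : ℝ, 0 ≤ s → 0 ≤ t → toFun (s + t) = (toFun s).comp (toFun t)
  continuousOn : ∀ x : H, ContinuousOn (fun t => toFun t x) (Ici 0)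

/-- The semigroup consists of contractions. -/
def C0Semigroup.IsContractive {H : Type*} [NormedAddCommGroup H] [NormedSpace ℝ H]
    (S : C0Semigroup H) : Prop :=
  ∀ t : ℝ, 0 ≤ t → ∀ x : H, ‖S.toFun t x‖ ≤ ‖x‖

/-- `x` belongs to the domain of the infinitesimal generator of `S`, and the generator maps `x`
to `y`. -/
def C0Semigroup.GeneratorMaps {H : Type*} [NormedAddCommGroup H] [NormedSpace ℝ H]
    (S : C0Semigroup H) (x y : H) : Prop :=
  Tendsto (fun t : ℝ => t⁻¹ • (S.toFun t x - x)) (𝓝[>] 0) (𝓝 y)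

section Triple

variable {H V : Type*} [NormedAddCommGroup H] [InnerProductSpace ℝ H]
  [NormedAddCommGroup V] [InnerProductSpace ℝ V]

/-- In the Gelfand triple `V ↪ H = H' ↪ V'` with embedding `ι : V → H`, the functional `φ ∈ V'`
belongs to `H` and is identified with `h ∈ H`: `⟨φ, v⟩ = (h, v)_H` for all `v ∈ V`. -/
def BelongsToPivot (ι : V →L[ℝ] H) (φ : StrongDual ℝ V) (h : H) : Prop :=
  ∀ v : V, φ v = ⟪h, ι v⟫

/-- The operator `L : V → V'`, restricted to the domain `{v ∈ V | L v ∈ H}` and seen as an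
unbounded operator of `H`, is the infinitesimal generator of the semigroup `S`
(same domain and same values). -/
def Generates (ι : V →L[ℝ] H) (L : V →L[ℝ] StrongDual ℝ V) (S : C0Semigroup H) : Prop :=
  ∀ x y : H, S.GeneratorMaps x y ↔ ∃ v : V, ι v = x ∧ BelongsToPivot ι (L v) y

end Triple

/-- The data of the abstract evolution equation `x' + A₁ x + B(t) x = 0`:
the dense continuous embedding `V ↪ H`, the control space `U = ∏ U_j` with `U_j` a closed subspace
of `L²(X_j, μ_j)^{N_j}`, the bounded operators `I_U : V → U` and `A₁ : V → V'`, the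
time-dependent coefficients `α_j`, and the nonlinearities `g_j`. -/
structure DampedSystem (H V : Type*) [NormedAddCommGroup H] [InnerProductSpace ℝ H]
    [NormedAddCommGroup V] [InnerProductSpace ℝ V] {J : ℕ} (N : Fin J → ℕ)
    (X : Fin J → Type*) [∀ j, MetricSpace (X j)] [∀ j, MeasurableSpace (X j)]
    (μ : ∀ j, Measure (X j)) where
  /-- the embedding of `V` into `H` -/
  ι : V →L[ℝ] H
  ι_injective : Function.Injective ι
  ι_denseRange : DenseRange ι
  /-- the factors of the control space -/
  U : ∀ j, Submodule ℝ (Lp (EuclideanSpace ℝ (Fin (N j))) 2 (μ j))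
  U_closed : ∀ j, IsClosed (U j : Set (Lp (EuclideanSpace ℝ (Fin (N j))) 2 (μ j)))
  /-- the canonical continuous linear map of `V` into the control space (the product carries its
  Hilbert structure) -/
  IU : V →L[ℝ] PiLp 2 (fun j => U j)
  /-- the coefficients `α_j(t, x)`, for `t ≥ 0` -/
  α : ∀ j, ℝ → X j → ℝ
  α_continuousOn : ∀ j, ContinuousOn (fun p : ℝ × X j => α j p.1 p.2) (Ici 0 ×ˢ univ)
  α_pos : ∀ j, ∀ t : ℝ, 0 ≤ t → ∀ x : X j, 0 < α j t x
  α_lipschitz : ∀ j, ∀ T : ℝ, 0 < T → ∃ κ : ℝ, 0 < κ ∧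
    ∀ s ∈ Icc (0 : ℝ) T, ∀ t ∈ Icc (0 : ℝ) T, ∀ x : X j, |α j t x - α j s x| ≤ κ * |t - s|
  /-- the nonlinearities `g_j` -/
  g : ∀ j, EuclideanSpace ℝ (Fin (N j)) → EuclideanSpace ℝ (Fin (N j))
  g_continuous : ∀ j, Continuous (g j)
  g_monotone : ∀ j, ∀ x y, 0 ≤ ⟪g j x - g j y, x - y⟫
  g_zero : ∀ j, g j 0 = 0
  g_growth : ∃ M : ℝ, 0 < M ∧ ∀ j, ∀ x, ‖g j x‖ ≤ M * (1 + ‖x‖)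
  /-- the bounded linear operator `A₁ : V → V'` -/
  A₁ : V →L[ℝ] StrongDual ℝ V

namespace DampedSystem

variable {H V : Type*} [NormedAddCommGroup H] [InnerProductSpace ℝ H]
  [NormedAddCommGroup V] [InnerProductSpace ℝ V] {J : ℕ} {N : Fin J → ℕ}
  {X : Fin J → Type*} [∀ j, MetricSpace (X j)] [∀ j, MeasurableSpace (X j)]
  {μ : ∀ j, Measure (X j)} (P : DampedSystem H V N X μ)

/-- The `j`-th component `(I_U u)_j` of `I_U u`, as a function on `X_j`
(defined up to a `μ_j`-null set). -/
def comp (u : V) (j : Fin J) : X j → EuclideanSpace ℝ (Fin (N j)) :=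
  ((P.IU u j : P.U j) : Lp (EuclideanSpace ℝ (Fin (N j))) 2 (μ j))

/-- The operator `I_U`, seen as an operator of `V` into `V'`:
`⟨I_U u, v⟩ = (I_U u, I_U v)_U`. -/
def IUdual : V →L[ℝ] StrongDual ℝ V :=
  (innerSL ℝ (E := PiLp 2 (fun j => P.U j))).bilinearComp P.IU P.IU

/-- `b = B(t) u` in `V'`, that is,
`⟨b, v⟩ = ∑ j, ∫ α_j(t, x) g_j((I_U u)_j(x)) · (I_U v)_j(x) dμ_j(x)` for all `v ∈ V`,
with convergent integrals. -/
def IsFeedback (t : ℝ) (u : V) (b : StrongDual ℝ V) : Prop :=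
  ∀ v : V,
    (∀ j, Integrable (fun x => P.α j t x * ⟪P.g j (P.comp u j x), P.comp v j x⟫) (μ j)) ∧
    b v = ∑ j, ∫ x, P.α j t x * ⟪P.g j (P.comp u j x), P.comp v j x⟫ ∂(μ j)

/-- `u` belongs to the domain `{u ∈ V | (A₁ + B(t)) u ∈ H}` of the operator `𝒜_B(t)`, and
`𝒜_B(t) u = h`. -/
def OperatorMaps (t : ℝ) (u : V) (h : H) : Prop :=
  ∃ b : StrongDual ℝ V, P.IsFeedback t u b ∧ BelongsToPivot P.ι (P.A₁ u + b) h

/-- `x` is a solution of `x' + A₁ x + B(t) x = 0`, `x(0) = x₀`: it is continuous on `[0, ∞)` with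
values in `H`, `x(t)` belongs to the domain of `𝒜_B(t)` for every `t ≥ 0`, and outside a countable
set of times the strong derivative `x'(t) = -𝒜_B(t) x(t)` exists in `H` and is continuous.
As `x(t) ∈ V` for all `t ≥ 0`, solutions are written as functions with values in `V`; their values
at negative times are irrelevant. -/
structure IsSolution (x₀ : H) (x : ℝ → V) : Prop where
  continuousOn : ContinuousOn (fun t => P.ι (x t)) (Ici 0)
  mem_domain : ∀ t : ℝ, 0 ≤ t → ∃ h : H, P.OperatorMaps t (x t) h
  equation : ∃ Z : Set ℝ, Z.Countable ∧ ∃ x' : ℝ → H, ContinuousOn x' (Ici 0 \ Z) ∧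
    ∀ t ∈ Ici (0 : ℝ) \ Z,
      HasDerivWithinAt (fun s => P.ι (x s)) (x' t) (Ici 0) t ∧ P.OperatorMaps t (x t) (-x' t)
  initial : P.ι (x 0) = x₀

/-- The energy `½ ‖x(t)‖²_H`. -/
def energy (x : ℝ → V) (t : ℝ) : ℝ := 1 / 2 * ‖P.ι (x t)‖ ^ 2

/-- The quantity
`∑ j, ∫_a^b ∫_{X_j} (|(I_U x(t))_j|² + α_j(t, ·)² |g_j((I_U x(t))_j)|²) dμ_j dt ∈ [0, ∞]`. -/
def observation (x : ℝ → V) (a b : ℝ) : ℝ≥0∞ :=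
  ∑ j, ∫⁻ t in Ioc a b, ∫⁻ y, ENNReal.ofReal
    (‖P.comp (x t) j y‖ ^ 2 + P.α j t y ^ 2 * ‖P.g j (P.comp (x t) j y)‖ ^ 2) ∂(μ j)

end DampedSystem

end

/-!
Let `y(t) = S(t - a) z` be an orbit of the semigroup generated by `-A₁ - I_U`, and put
`p = I_U x(t)`, `q = I_U y(t)`, `w = α g(p)`. As `A₁` is antisymmetric, `d/dt ‖x - y‖²` is a sum of
integrals of `2 ⟪q - w, p - q⟫ ≤ ‖p‖² + ‖w‖²`: completing the square bounds it by the
observation density whatever `q` is. Integrating for `z` in the domain of the generator, and then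
letting `z` tend to `x(a)`, gives `‖x(b) - S(b - a) x(a)‖² ≤ O`, where `O` is the observation; the
choice `y = 0` gives `‖x(a)‖² ≤ ‖x(b)‖² + 2 O`. If `‖S(b - a)‖ ≤ 1/2`, the two bounds together
yield `‖x(b)‖² ≤ 6 O`.

A solution is continuous only with values in `H`. That `t ↦ x(t)` is measurable with values in `V`,
so that sums and integrals in `O` may be exchanged, comes from approximating the inverse of the
injection `V → H` pointwise by bounded operators.
-/

section Calculus

variable {E : Type*} [NormedAddCommGroup E] [NormedSpace ℝ E]

theorem hasDerivWithinAt_Ioi_iff_tendsto_slope_zero {f : ℝ → E} {f' : E} {x : ℝ} :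
    HasDerivWithinAt f f' (Ioi x) x ↔
      Tendsto (fun t : ℝ => t⁻¹ • (f (x + t) - f x)) (𝓝[>] 0) (𝓝 f') := by
  have h : 𝓝[>] x = Filter.map (x + ·) (𝓝[>] 0) := by simp
  rw [hasDerivWithinAt_iff_tendsto_slope' self_notMem_Ioi, h, tendsto_map'_iff]
  simp only [Function.comp_def, slope, add_sub_cancel_left, vsub_eq_sub]

theorem hasDerivAt_of_hasDerivWithinAt_Ioi [CompleteSpace E] {f f' : ℝ → E} {s : Set ℝ}
    (hs : IsOpen s) (hf : ContinuousOn f s) (hf' : ContinuousOn f' s)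
    (hderiv : ∀ t ∈ s, HasDerivWithinAt f (f' t) (Ioi t) t) {t : ℝ} (ht : t ∈ s) :
    HasDerivAt f (f' t) t := by
  obtain ⟨a, b, ⟨hat, htb⟩, hab⟩ := mem_nhds_iff_exists_Ioo_subset.1 (hs.mem_nhds ht)
  obtain ⟨c, hac, hct⟩ := exists_between hat
  have hsub : ∀ r < b, Icc c r ⊆ s := fun r hr q hq =>
    hab ⟨hac.trans_le hq.1, hq.2.trans_lt hr⟩
  have hint : ∀ r ∈ Ico c b, IntervalIntegrable f' volume c r := fun r hr =>
    (hf'.mono (hsub r hr.2)).intervalIntegrable_of_Icc hr.1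
  have hFTC : ∀ r ∈ Ioo c b, f r = (∫ q in c..r, f' q) + f c := fun r hr => by
    rw [intervalIntegral.integral_eq_sub_of_hasDeriv_right_of_le hr.1.le (hf.mono (hsub r hr.2))
      (fun q hq => hderiv q (hsub r hr.2 (Ioo_subset_Icc_self hq))) (hint r ⟨hr.1.le, hr.2⟩),
      sub_add_cancel]
  have hprim : HasDerivAt (fun r => (∫ q in c..r, f' q) + f c) (f' t) t :=
    (intervalIntegral.integral_hasDerivAt_right (hint t ⟨hct.le, htb⟩)
      (hf'.stronglyMeasurableAtFilter hs t ht) (hf'.continuousAt (hs.mem_nhds ht))).add_const _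
  exact hprim.congr_of_eventuallyEq (eventually_of_mem (Ioo_mem_nhds hct htb) hFTC)

end Calculus

section LowerIntegral

theorem ofReal_integral_le_lintegral_ofReal {Y : Type*} [MeasurableSpace Y] {ν : Measure Y}
    (f : Y → ℝ) : ENNReal.ofReal (∫ y, f y ∂ν) ≤ ∫⁻ y, ENNReal.ofReal (f y) ∂ν := by
  by_cases hf : Integrable f ν
  · rw [integral_eq_lintegral_pos_part_sub_lintegral_neg_part hf]
    exact (ENNReal.ofReal_le_ofReal (sub_le_self _ ENNReal.toReal_nonneg)).trans
      ENNReal.ofReal_toReal_le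
  · simp [integral_undef hf]

theorem ofReal_sub_le_lintegral_of_hasDerivAt_off_countable {φ : ℝ → ℝ} {Φ Ψ : ℝ → ℝ≥0∞}
    {a b : ℝ} (hab : a ≤ b) (hφ : ContinuousOn φ (Icc a b)) {Z : Set ℝ} (hZ : Z.Countable)
    (hd : ∀ t ∈ Ioo a b \ Z, ∃ d, HasDerivAt φ d t ∧ ENNReal.ofReal d ≤ Φ t ∧ ‖d‖ₑ ≤ Ψ t)
    (hΨ : ∫⁻ t in Ioc a b, Ψ t ≠ ∞) :
    ENNReal.ofReal (φ b - φ a) ≤ ∫⁻ t in Ioc a b, Φ t := by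
  have hderiv : ∀ t ∈ Ioo a b \ Z,
      HasDerivAt φ (deriv φ t) t ∧ ENNReal.ofReal (deriv φ t) ≤ Φ t ∧ ‖deriv φ t‖ₑ ≤ Ψ t := by
    intro t ht
    obtain ⟨d, hdt, hbounds⟩ := hd t ht
    rw [hdt.deriv]
    exact ⟨hdt, hbounds⟩
  have hae : ∀ᵐ t ∂volume.restrict (Ioc a b), t ∈ Ioo a b \ Z := by
    rw [← restrict_Ioo_eq_restrict_Ioc]
    filter_upwards [ae_restrict_mem measurableSet_Ioo, ae_restrict_of_ae (hZ.ae_notMem volume)]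
      with t ht htZ using ⟨ht, htZ⟩
  have hint : IntegrableOn (deriv φ) (Ioc a b) :=
    ⟨(measurable_deriv φ).aestronglyMeasurable,
      (lintegral_mono_ae (hae.mono fun t ht => (hderiv t ht).2.2)).trans_lt hΨ.lt_top⟩
  calc ENNReal.ofReal (φ b - φ a) = ENNReal.ofReal (∫ t in Ioc a b, deriv φ t) := by
        rw [← integral_eq_of_hasDerivAt_off_countable_of_le φ (deriv φ) hab hZ hφ
          (fun t ht => (hderiv t ht).1)
          ((intervalIntegrable_iff_integrableOn_Ioc_of_le hab).2 hint),
          intervalIntegral.integral_of_le hab]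
    _ ≤ ∫⁻ t in Ioc a b, ENNReal.ofReal (deriv φ t) := ofReal_integral_le_lintegral_ofReal _
    _ ≤ ∫⁻ t in Ioc a b, Φ t := lintegral_mono_ae (hae.mono fun t ht => (hderiv t ht).2.1)

end LowerIntegral

section InnerProduct

variable {E : Type*} [NormedAddCommGroup E] [InnerProductSpace ℝ E] (p q w : E)

/-- The difference of the two sides is `2 ‖q - (p + w) / 2‖ ^ 2 + ‖p + w‖ ^ 2 / 2`. -/
theorem two_mul_inner_sub_sub_le : 2 * ⟪q - w, p - q⟫ ≤ ‖p‖ ^ 2 + ‖w‖ ^ 2 := by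
  have hsum : 0 ≤ ⟪p + w, p + w⟫ := real_inner_self_nonneg
  have hmid : 0 ≤ ⟪(2 : ℝ) • q - (p + w), (2 : ℝ) • q - (p + w)⟫ := real_inner_self_nonneg
  simp only [inner_sub_left, inner_sub_right, inner_add_left, inner_add_right,
    real_inner_smul_left, real_inner_smul_right, real_inner_self_eq_norm_sq, norm_smul,
    Real.norm_ofNat] at hsum hmid ⊢
  linarith [real_inner_comm p q, real_inner_comm p w, real_inner_comm q w]

theorem abs_two_mul_inner_sub_sub_le :
    |2 * ⟪q - w, p - q⟫| ≤ 2 * (‖p‖ ^ 2 + ‖w‖ ^ 2) + 4 * ‖q‖ ^ 2 :=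
  calc |2 * ⟪q - w, p - q⟫| = 2 * |⟪q - w, p - q⟫| := by rw [abs_mul, abs_two]
    _ ≤ 2 * (‖q - w‖ * ‖p - q‖) := by gcongr; exact abs_real_inner_le_norm _ _
    _ ≤ 2 * ((‖q‖ + ‖w‖) * (‖p‖ + ‖q‖)) := by gcongr <;> exact norm_sub_le _ _
    _ ≤ 2 * (‖p‖ ^ 2 + ‖w‖ ^ 2) + 4 * ‖q‖ ^ 2 := by
        nlinarith [sq_nonneg (‖p‖ - ‖q‖), sq_nonneg (‖q‖ - ‖w‖), sq_nonneg (‖p‖ - ‖w‖)]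

end InnerProduct

namespace C0Semigroup

variable {H : Type*} [NormedAddCommGroup H] [NormedSpace ℝ H] (S : C0Semigroup H)

theorem toFun_add_apply {s t : ℝ} (hs : 0 ≤ s) (ht : 0 ≤ t) (x : H) :
    S.toFun (s + t) x = S.toFun s (S.toFun t x) := by
  rw [S.map_add s t hs ht, ContinuousLinearMap.comp_apply]

theorem toFun_comm_apply {s t : ℝ} (hs : 0 ≤ s) (ht : 0 ≤ t) (x : H) :
    S.toFun s (S.toFun t x) = S.toFun t (S.toFun s x) := by
  rw [← S.toFun_add_apply hs ht, ← S.toFun_add_apply ht hs, add_comm]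

theorem intervalIntegrable {a b : ℝ} (ha : 0 ≤ a) (hb : 0 ≤ b) (x : H) :
    IntervalIntegrable (fun t => S.toFun t x) volume a b :=
  ((S.continuousOn x).mono fun _ ht => (le_min ha hb).trans ht.1).intervalIntegrable

section Generator

variable {S} {x y : H}

theorem GeneratorMaps.apply (h : S.GeneratorMaps x y) {t : ℝ} (ht : 0 ≤ t) :
    S.GeneratorMaps (S.toFun t x) (S.toFun t y) := by
  refine (((S.toFun t).continuous.tendsto y).comp h).congr' ?_
  filter_upwards [self_mem_nhdsWithin] with s hs
  rw [Function.comp_apply, map_smul, map_sub, S.toFun_comm_apply ht (mem_Ioi.1 hs).le]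

theorem GeneratorMaps.hasDerivWithinAt (h : S.GeneratorMaps x y) {t : ℝ} (ht : 0 ≤ t) :
    HasDerivWithinAt (fun s => S.toFun s x) (S.toFun t y) (Ioi t) t := by
  rw [hasDerivWithinAt_Ioi_iff_tendsto_slope_zero]
  refine (h.apply ht).congr' ?_
  filter_upwards [self_mem_nhdsWithin] with s hs
  rw [add_comm t s, S.toFun_add_apply (mem_Ioi.1 hs).le ht]

theorem GeneratorMaps.hasDerivAt [CompleteSpace H] (h : S.GeneratorMaps x y) {t : ℝ}
    (ht : 0 < t) : HasDerivAt (fun s => S.toFun s x) (S.toFun t y) t :=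
  hasDerivAt_of_hasDerivWithinAt_Ioi isOpen_Ioi ((S.continuousOn x).mono Ioi_subset_Ici_self)
    ((S.continuousOn y).mono Ioi_subset_Ici_self)
    (fun _ hs => h.hasDerivWithinAt (mem_Ioi.1 hs).le) ht

end Generator

variable [CompleteSpace H]

theorem tendsto_average (x : H) {t : ℝ} (ht : 0 ≤ t) :
    Tendsto (fun h : ℝ => h⁻¹ • ∫ r in t..t + h, S.toFun r x) (𝓝[>] 0) (𝓝 (S.toFun t x)) := by
  have hsub : Ioi t ⊆ Ici 0 := fun r hr => ht.trans (mem_Ioi.1 hr).le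
  have hderiv : HasDerivWithinAt (fun b => ∫ r in t..b, S.toFun r x) (S.toFun t x) (Ioi t) t :=
    (intervalIntegral.integral_hasDerivWithinAt_right (S.intervalIntegrable ht ht x)
      (((S.continuousOn x).mono hsub).stronglyMeasurableAtFilter_nhdsWithin measurableSet_Ioi t)
      ((S.continuousOn x t ht).mono hsub)).Ioi_of_Ici
  simpa using hasDerivWithinAt_Ioi_iff_tendsto_slope_zero.1 hderiv

theorem toFun_integral (x : H) {h t : ℝ} (hh : 0 ≤ h) (ht : 0 ≤ t) :
    S.toFun h (∫ r in (0 : ℝ)..t, S.toFun r x) = ∫ r in h..t + h, S.toFun r x :=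
  calc S.toFun h (∫ r in (0 : ℝ)..t, S.toFun r x)
    _ = ∫ r in (0 : ℝ)..t, S.toFun h (S.toFun r x) :=
        ((S.toFun h).intervalIntegral_comp_comm (S.intervalIntegrable le_rfl ht x)).symm
    _ = ∫ r in (0 : ℝ)..t, S.toFun (r + h) x := by
        refine intervalIntegral.integral_congr fun r hr => ?_
        rw [uIcc_of_le ht] at hr
        rw [add_comm, S.toFun_add_apply hh hr.1]
    _ = ∫ r in h..t + h, S.toFun r x := by
        rw [intervalIntegral.integral_comp_add_right (fun r => S.toFun r x), zero_add]

theorem generatorMaps_integral (x : H) {t : ℝ} (ht : 0 ≤ t) :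
    S.GeneratorMaps (∫ r in (0 : ℝ)..t, S.toFun r x) (S.toFun t x - x) := by
  have hlim := (S.tendsto_average x ht).sub (S.tendsto_average x le_rfl)
  rw [S.map_zero, ContinuousLinearMap.id_apply] at hlim
  refine hlim.congr' ?_
  filter_upwards [self_mem_nhdsWithin] with h hh
  have hh : 0 ≤ h := (mem_Ioi.1 hh).le
  have hth : 0 ≤ t + h := add_nonneg ht hh
  rw [← smul_sub, S.toFun_integral x hh ht, zero_add,
    intervalIntegral.integral_interval_sub_interval_comm' (S.intervalIntegrable ht hth x)
      (S.intervalIntegrable le_rfl hh x) (S.intervalIntegrable ht le_rfl x)]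

theorem dense_domain : Dense {x : H | ∃ y, S.GeneratorMaps x y} := by
  intro x
  have hlim := S.tendsto_average x le_rfl
  rw [S.map_zero, ContinuousLinearMap.id_apply] at hlim
  refine mem_closure_of_tendsto hlim ?_
  filter_upwards [self_mem_nhdsWithin] with t ht
  have hgen := S.generatorMaps_integral x (mem_Ioi.1 ht).le
  refine ⟨t⁻¹ • (S.toFun t x - x), (hgen.const_smul t⁻¹).congr fun s => ?_⟩
  rw [zero_add, map_smul, ← smul_sub, smul_comm]

end C0Semigroup

section InjectiveOperator

variable {𝕜 E F : Type*} [RCLike 𝕜] [NormedAddCommGroup E] [InnerProductSpace 𝕜 E]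
  [CompleteSpace E] [NormedAddCommGroup F] [InnerProductSpace 𝕜 F] [CompleteSpace F]

open ContinuousLinearMap

theorem norm_one_sub_smul_adjoint_comp_self_le_one (A : E →L[𝕜] F) {c : ℝ} (hc : 0 ≤ c)
    (hcA : c * ‖A‖ ^ 2 ≤ 1) : ‖1 - (c : 𝕜) • (adjoint A ∘L A)‖ ≤ 1 := by
  refine opNorm_le_bound _ zero_le_one fun v => ?_
  rw [one_mul]
  have hadj : c * ‖adjoint A (A v)‖ ^ 2 ≤ ‖A v‖ ^ 2 :=
    calc c * ‖adjoint A (A v)‖ ^ 2 ≤ c * (‖A‖ * ‖A v‖) ^ 2 := by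
          gcongr
          simpa using (adjoint A).le_opNorm (A v)
      _ = c * ‖A‖ ^ 2 * ‖A v‖ ^ 2 := by ring
      _ ≤ ‖A v‖ ^ 2 := mul_le_of_le_one_left (by positivity) hcA
  have hinner : RCLike.re (inner 𝕜 v ((c : 𝕜) • adjoint A (A v))) = c * ‖A v‖ ^ 2 := by
    rw [inner_smul_right, adjoint_inner_right, RCLike.re_ofReal_mul,
      inner_self_eq_norm_sq]
  refine (sq_le_sq₀ (norm_nonneg _) (norm_nonneg _)).1 ?_
  simp only [sub_apply, one_apply_eq_self, smul_apply, comp_apply]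
  rw [norm_sub_sq (𝕜 := 𝕜), hinner, norm_smul, RCLike.norm_ofReal, mul_pow, sq_abs]
  nlinarith [mul_le_mul_of_nonneg_left hadj hc, mul_nonneg hc (sq_nonneg ‖A v‖)]

/-- With `f = 1 - c A†A` a contraction without nonzero fixed point, the averages of `fᵏ v` tend
to `0` by the mean ergodic theorem, while `1 - fᵏ = (∑ i < k, fⁱ) c A†A` factors through `A`. -/
theorem exists_tendsto_leftInverse_of_injective (A : E →L[𝕜] F) (hA : Function.Injective A) :
    ∃ L : ℕ → F →L[𝕜] E, ∀ v, Tendsto (fun n => L n (A v)) atTop (𝓝 v) := by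
  set c : ℝ := (1 + ‖A‖ ^ 2)⁻¹
  have hc : 0 < c := by positivity
  have hcA : c * ‖A‖ ^ 2 ≤ 1 :=
    (inv_mul_le_one₀ (by positivity)).2 (le_add_of_nonneg_left zero_le_one)
  set f : E →L[𝕜] E := 1 - (c : 𝕜) • (adjoint A ∘L A) with hf
  have hfix : f.eqLocus (1 : E →L[𝕜] E) = ⊥ := by
    refine (Submodule.eq_bot_iff _).2 fun v hv => hA ?_
    have hAA : adjoint A (A v) = 0 := by
      have hv' : f v = v := hv
      simpa [hf, hc.ne'] using hv'
    rw [map_zero, ← inner_self_eq_zero (𝕜 := 𝕜), ← adjoint_inner_right, hAA, inner_zero_right]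
  refine ⟨fun n => (n : 𝕜)⁻¹ • (∑ k ∈ Finset.range n, ∑ i ∈ Finset.range k, f ^ i) ∘L
    ((c : 𝕜) • adjoint A), fun v => ?_⟩
  have hgeom : ∀ k, (∑ i ∈ Finset.range k, f ^ i) ((c : 𝕜) • adjoint A (A v)) = v - f^[k] v := by
    intro k
    have := DFunLike.congr_fun (geom_sum_mul_neg f k) v
    rwa [hf, sub_sub_cancel, ← hf, mul_apply_eq_comp, smul_apply, comp_apply, sub_apply,
      one_apply_eq_self, pow_apply_eq_iterate] at this
  have hlim : Tendsto (fun n => v - birkhoffAverage 𝕜 f id n v) atTop (𝓝 v) := by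
    have hproj := (Submodule.mem_bot 𝕜).1
      (hfix.le ((f.eqLocus (1 : E →L[𝕜] E)).orthogonalProjectionOnto v).2)
    have hmean := tendsto_birkhoffAverage_orthogonalProjection f
      (norm_one_sub_smul_adjoint_comp_self_le_one A hc.le hcA) v
    simpa only [hproj, sub_zero] using hmean.const_sub v
  refine hlim.congr' ?_
  filter_upwards [eventually_ne_atTop 0] with n hn
  have hn : (n : 𝕜) ≠ 0 := Nat.cast_ne_zero.2 hn
  simp only [smul_apply, comp_apply, sum_apply] at hgeom ⊢
  simp only [hgeom, Finset.sum_sub_distrib, smul_sub, birkhoffAverage, birkhoffSum,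
    Finset.sum_const, Finset.card_range, ← Nat.cast_smul_eq_nsmul 𝕜, inv_smul_smul₀ hn, id]

theorem stronglyMeasurable_of_injective_comp {α : Type*} [MeasurableSpace α] (A : E →L[𝕜] F)
    (hA : Function.Injective A) {f : α → E} (hf : StronglyMeasurable fun a => A (f a)) :
    StronglyMeasurable f := by
  obtain ⟨L, hL⟩ := exists_tendsto_leftInverse_of_injective A hA
  exact stronglyMeasurable_of_tendsto atTop
    (fun n => (L n).continuous.comp_stronglyMeasurable hf) (tendsto_pi_nhds.2 fun a => hL (f a))

end InjectiveOperator

section LowerSemicontinuity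

theorem measurable_comp_of_lowerSemicontinuous {α β γ : Type*} [MeasurableSpace α]
    [TopologicalSpace β] [TopologicalSpace.PseudoMetrizableSpace β]
    [TopologicalSpace γ] [MeasurableSpace γ] [BorelSpace γ] [LinearOrder γ] [OrderTopology γ]
    [SecondCountableTopology γ] {G : β → γ} (hG : LowerSemicontinuous G) {f : α → β}
    (hf : StronglyMeasurable f) : Measurable fun a => G (f a) := by
  borelize β
  exact hG.measurable.comp hf.measurable

theorem lowerSemicontinuous_lintegral_Lp {Z Y E : Type*} [TopologicalSpace Z]
    [FirstCountableTopology Z] [MeasurableSpace Y] {ν : Measure Y} [NormedAddCommGroup E]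
    {p : ℝ≥0∞} [Fact (1 ≤ p)] {F : Z → Y → E → ℝ≥0∞}
    (hF : ∀ y, LowerSemicontinuous fun q : Z × E => F q.1 y q.2)
    (hFm : ∀ z (u : Lp E p ν), AEMeasurable (fun y => F z y (u y)) ν) :
    LowerSemicontinuous fun q : Z × Lp E p ν => ∫⁻ y, F q.1 y (q.2 y) ∂ν := by
  refine lowerSemicontinuous_iff_isClosed_preimage.2 fun c => IsSeqClosed.isClosed ?_
  rintro q ⟨z, u⟩ hq hlim
  have hz : Tendsto (fun n => (q n).1) atTop (𝓝 z) := (continuous_fst.tendsto _).comp hlim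
  have hu : Tendsto (fun n => (q n).2) atTop (𝓝 u) := (continuous_snd.tendsto _).comp hlim
  obtain ⟨ns, hns, hae⟩ := (tendstoInMeasure_of_tendsto_Lp hu).exists_seq_tendsto_ae
  calc ∫⁻ y, F z y (u y) ∂ν
    _ ≤ ∫⁻ y, liminf (fun n => F (q (ns n)).1 y ((q (ns n)).2 y)) atTop ∂ν := by
        refine lintegral_mono_ae (hae.mono fun y hy => ?_)
        exact ((hF y).le_liminf (z, u y)).trans
          (liminf_le_liminf_of_le ((hz.comp hns.tendsto_atTop).prodMk_nhds hy))
    _ ≤ liminf (fun n => ∫⁻ y, F (q (ns n)).1 y ((q (ns n)).2 y) ∂ν) atTop :=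
        lintegral_liminf_le' fun n => hFm _ _
    _ ≤ c := by
        refine liminf_le_of_le (by isBoundedDefault) fun b hb => ?_
        obtain ⟨n, hn⟩ := hb.exists
        exact hn.trans (hq (ns n))

end LowerSemicontinuity

namespace DampedSystem

variable {H V : Type*} [NormedAddCommGroup H] [InnerProductSpace ℝ H]
  [NormedAddCommGroup V] [InnerProductSpace ℝ V] {J : ℕ} {N : Fin J → ℕ}
  {X : Fin J → Type*} [∀ j, MetricSpace (X j)] [∀ j, MeasurableSpace (X j)]
  {μ : ∀ j, Measure (X j)} (P : DampedSystem H V N X μ)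

/-- The contribution of the `j`-th factor at time `t` and state `u` to the time integrand of
`DampedSystem.observation`. -/
noncomputable def observationDensity (j : Fin J) (t : ℝ) (u : V) : ℝ≥0∞ :=
  ∫⁻ y, ENNReal.ofReal
    (‖P.comp u j y‖ ^ 2 + P.α j t y ^ 2 * ‖P.g j (P.comp u j y)‖ ^ 2) ∂(μ j)

/-- The bounded linear map `u ↦ (I_U u)_j` with values in `L²(X_j, μ_j)^{N_j}`; the functions
`DampedSystem.comp` are its representatives. -/
noncomputable def compLp (j : Fin J) : V →L[ℝ] Lp (EuclideanSpace ℝ (Fin (N j))) 2 (μ j) :=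
  (P.U j).subtypeL ∘L PiLp.proj 2 (fun j => P.U j) j ∘L P.IU

theorem coe_compLp (u : V) (j : Fin J) : P.compLp j u = P.comp u j := rfl

theorem memLp_comp (u : V) (j : Fin J) : MemLp (P.comp u j) 2 (μ j) := Lp.memLp (P.compLp j u)

theorem comp_sub (u v : V) (j : Fin J) :
    P.comp (u - v) j =ᵐ[μ j] P.comp u j - P.comp v j := by
  simp only [← coe_compLp, map_sub]
  exact Lp.coeFn_sub _ _

section Measurability

theorem continuous_uncurry_α (j : Fin J) :
    Continuous fun p : Ici (0 : ℝ) × X j => P.α j p.1 p.2 :=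
  (P.α_continuousOn j).comp_continuous (f := fun p : Ici (0 : ℝ) × X j => ((p.1 : ℝ), p.2))
    (by fun_prop) fun p => ⟨p.1.2, mem_univ _⟩

variable [∀ j, OpensMeasurableSpace (X j)]

theorem lowerSemicontinuous_observationDensity (j : Fin J) :
    LowerSemicontinuous fun p : Ici (0 : ℝ) × V => P.observationDensity j p.1 p.2 := by
  have hα := P.continuous_uncurry_α j
  have hg := P.g_continuous j
  suffices LowerSemicontinuous fun p : Ici (0 : ℝ) × Lp (EuclideanSpace ℝ (Fin (N j))) 2 (μ j) =>
      ∫⁻ y, ENNReal.ofReal (‖p.2 y‖ ^ 2 + P.α j p.1 y ^ 2 * ‖P.g j (p.2 y)‖ ^ 2) ∂(μ j) by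
    simp only [observationDensity, ← coe_compLp]
    exact this.comp (g := fun p : Ici (0 : ℝ) × V => (p.1, P.compLp j p.2))
      (continuous_fst.prodMk ((P.compLp j).continuous.comp continuous_snd))
  refine lowerSemicontinuous_lintegral_Lp
    (F := fun (t : Ici (0 : ℝ)) y e => ENNReal.ofReal (‖e‖ ^ 2 + P.α j t y ^ 2 * ‖P.g j e‖ ^ 2))
    (fun y => ?_) fun t u => ?_
  · have hαy : Continuous fun t : Ici (0 : ℝ) => P.α j t y := hα.comp (Continuous.prodMk_left y)
    exact (ENNReal.continuous_ofReal.comp ((continuous_snd.norm.pow 2).add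
      (((hαy.comp continuous_fst).pow 2).mul
        ((hg.comp continuous_snd).norm.pow 2)))).lowerSemicontinuous
  · have hu : AEStronglyMeasurable u (μ j) := Lp.aestronglyMeasurable u
    have hαt : Measurable (P.α j t) := (hα.comp (Continuous.prodMk_right t)).measurable
    have hgu := hg.comp_aestronglyMeasurable hu
    exact ((hu.norm.aemeasurable.pow_const 2).add
      ((hαt.aemeasurable.pow_const 2).mul (hgu.norm.aemeasurable.pow_const 2))).ennreal_ofReal

variable [CompleteSpace H] [CompleteSpace V]

theorem aemeasurable_observationDensity {x : ℝ → V}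
    (hx : ContinuousOn (fun t => P.ι (x t)) (Ici 0)) (j : Fin J) :
    AEMeasurable (fun t => P.observationDensity j t (x t)) (volume.restrict (Ici 0)) := by
  have hxm : StronglyMeasurable fun t : Ici (0 : ℝ) => x t :=
    stronglyMeasurable_of_injective_comp P.ι P.ι_injective hx.domRestrict.stronglyMeasurable
  have hmeas : Measurable fun t : Ici (0 : ℝ) => P.observationDensity j t (x t) :=
    measurable_comp_of_lowerSemicontinuous (f := fun t : Ici (0 : ℝ) => (t, x t))
      (P.lowerSemicontinuous_observationDensity j) (stronglyMeasurable_id.prodMk hxm)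
  exact aemeasurable_restrict_of_measurable_subtype measurableSet_Ici hmeas

theorem observation_eq_lintegral {x : ℝ → V} (hx : ContinuousOn (fun t => P.ι (x t)) (Ici 0))
    {a b : ℝ} (ha : 0 ≤ a) :
    P.observation x a b = ∫⁻ t in Ioc a b, ∑ j, P.observationDensity j t (x t) :=
  (lintegral_finsetSum' _ fun j _ =>
    (P.aemeasurable_observationDensity hx j).mono_set fun _ ht => ha.trans ht.1.le).symm

end Measurability

section FeedbackEstimates

theorem IUdual_apply (u v : V) :
    P.IUdual u v = ∑ j, ∫ y, ⟪P.comp u j y, P.comp v j y⟫ ∂(μ j) := by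
  change ⟪P.IU u, P.IU v⟫ = _
  rw [PiLp.inner_apply]
  rfl

theorem sum_lintegral_norm_comp_sq (u : V) :
    ∑ j, ∫⁻ y, ENNReal.ofReal (‖P.comp u j y‖ ^ 2) ∂(μ j) = ENNReal.ofReal (P.IUdual u u) := by
  rw [IUdual_apply, ENNReal.ofReal_sum_of_nonneg fun j _ =>
    integral_nonneg fun y => real_inner_self_nonneg]
  refine Finset.sum_congr rfl fun j _ => ?_
  simp only [real_inner_self_eq_norm_sq]
  exact (ofReal_integral_eq_lintegral_ofReal ((P.memLp_comp u j).integrable_norm_pow two_ne_zero)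
    (Eventually.of_forall fun y => sq_nonneg _)).symm

variable {P} {t : ℝ} {u : V} {b : StrongDual ℝ V}

theorem IsFeedback.IUdual_apply_sub_apply (hb : P.IsFeedback t u b) (v w : V) :
    P.IUdual v w - b w = ∑ j, ∫ y,
      ⟪P.comp v j y - P.α j t y • P.g j (P.comp u j y), P.comp w j y⟫ ∂(μ j) := by
  rw [IUdual_apply, (hb w).2, ← Finset.sum_sub_distrib]
  refine Finset.sum_congr rfl fun j _ => ?_
  simp only [inner_sub_left, real_inner_smul_left]
  exact (integral_sub (L2.integrable_inner (𝕜 := ℝ) (P.compLp j v) (P.compLp j w))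
    ((hb w).1 j)).symm

theorem IsFeedback.two_mul_IUdual_apply_sub_apply (hb : P.IsFeedback t u b) (v : V) :
    2 * (P.IUdual v (u - v) - b (u - v)) = ∑ j, ∫ y,
      2 * ⟪P.comp v j y - P.α j t y • P.g j (P.comp u j y), P.comp u j y - P.comp v j y⟫
        ∂(μ j) := by
  rw [hb.IUdual_apply_sub_apply, Finset.mul_sum]
  refine Finset.sum_congr rfl fun j _ => ?_
  rw [← integral_const_mul]
  refine integral_congr_ae ?_
  filter_upwards [P.comp_sub u v j] with y hy
  rw [hy, Pi.sub_apply]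

theorem IsFeedback.ofReal_two_mul_le (hb : P.IsFeedback t u b) (v : V) :
    ENNReal.ofReal (2 * (P.IUdual v (u - v) - b (u - v)))
      ≤ ∑ j, P.observationDensity j t u := by
  rw [hb.two_mul_IUdual_apply_sub_apply]
  refine (Finset.le_sum_of_subadditive ENNReal.ofReal ENNReal.ofReal_zero.le
    (fun _ _ => ENNReal.ofReal_add_le) _ _).trans (Finset.sum_le_sum fun j _ => ?_)
  refine (ofReal_integral_le_lintegral_ofReal _).trans
    (lintegral_mono fun y => ENNReal.ofReal_le_ofReal ?_)
  simpa only [norm_smul, mul_pow, Real.norm_eq_abs, sq_abs] using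
    two_mul_inner_sub_sub_le (P.comp u j y) (P.comp v j y) (P.α j t y • P.g j (P.comp u j y))

theorem IsFeedback.enorm_two_mul_le (hb : P.IsFeedback t u b) (v : V) :
    ‖2 * (P.IUdual v (u - v) - b (u - v))‖ₑ
      ≤ 2 * ∑ j, P.observationDensity j t u + 4 * ENNReal.ofReal (P.IUdual v v) := by
  rw [hb.two_mul_IUdual_apply_sub_apply, ← sum_lintegral_norm_comp_sq, Finset.mul_sum,
    Finset.mul_sum, ← Finset.sum_add_distrib]
  refine (enorm_sum_le _ _).trans (Finset.sum_le_sum fun j _ => ?_)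
  have hv : AEMeasurable (fun y => ENNReal.ofReal (‖P.comp v j y‖ ^ 2)) (μ j) :=
    ((P.memLp_comp v j).1.norm.aemeasurable.pow_const 2).ennreal_ofReal
  rw [observationDensity, ← lintegral_const_mul' 2 _ ENNReal.ofNat_ne_top,
    ← lintegral_const_mul' 4 _ ENNReal.ofNat_ne_top, ← lintegral_add_right' _ (hv.const_mul 4)]
  refine (enorm_integral_le_lintegral_enorm _).trans (lintegral_mono fun y => ?_)
  rw [Real.enorm_eq_ofReal_abs]
  refine (ENNReal.ofReal_le_ofReal (abs_two_mul_inner_sub_sub_le (P.comp u j y) (P.comp v j y)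
    (P.α j t y • P.g j (P.comp u j y)))).trans_eq ?_
  rw [ENNReal.ofReal_add (by positivity) (by positivity), ENNReal.ofReal_mul zero_le_two,
    ENNReal.ofReal_mul zero_le_four, ENNReal.ofReal_ofNat, ENNReal.ofReal_ofNat, norm_smul,
    mul_pow, Real.norm_eq_abs, sq_abs]

end FeedbackEstimates

section Comparison

variable {t : ℝ} {u v : V} {p q : H}

theorem IUdual_self_eq_neg_inner (hA : ∀ u, P.A₁ u u = 0)
    (hv : BelongsToPivot P.ι ((-P.A₁ - P.IUdual) v) q) : P.IUdual v v = -⟪q, P.ι v⟫ := by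
  have h := hv v
  simp only [_root_.sub_apply, _root_.neg_apply, hA] at h
  linarith

variable {P}

theorem OperatorMaps.exists_isFeedback_inner_sub (hu : P.OperatorMaps t u (-p))
    (hA : ∀ u, P.A₁ u u = 0) (hv : BelongsToPivot P.ι ((-P.A₁ - P.IUdual) v) q) :
    ∃ b, P.IsFeedback t u b ∧ ⟪p - q, P.ι (u - v)⟫ = P.IUdual v (u - v) - b (u - v) := by
  obtain ⟨b, hb, hp⟩ := hu
  have hpu := hp (u - v)
  have hqv := hv (u - v)
  have hAuv := hA (u - v)
  rw [P.A₁.map_sub, _root_.sub_apply] at hAuv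
  simp only [_root_.add_apply, _root_.sub_apply, _root_.neg_apply, inner_neg_left] at hpu hqv
  refine ⟨b, hb, ?_⟩
  rw [inner_sub_left]
  linarith

theorem OperatorMaps.ofReal_two_mul_inner_sub_le (hu : P.OperatorMaps t u (-p))
    (hA : ∀ u, P.A₁ u u = 0) (hv : BelongsToPivot P.ι ((-P.A₁ - P.IUdual) v) q) :
    ENNReal.ofReal (2 * ⟪P.ι u - P.ι v, p - q⟫) ≤ ∑ j, P.observationDensity j t u := by
  obtain ⟨b, hb, hinner⟩ := hu.exists_isFeedback_inner_sub hA hv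
  rw [← map_sub, real_inner_comm, hinner]
  exact hb.ofReal_two_mul_le v

theorem OperatorMaps.enorm_two_mul_inner_sub_le (hu : P.OperatorMaps t u (-p))
    (hA : ∀ u, P.A₁ u u = 0) (hv : BelongsToPivot P.ι ((-P.A₁ - P.IUdual) v) q) :
    ‖2 * ⟪P.ι u - P.ι v, p - q⟫‖ₑ
      ≤ 2 * ∑ j, P.observationDensity j t u + 4 * ENNReal.ofReal (-⟪q, P.ι v⟫) := by
  obtain ⟨b, hb, hinner⟩ := hu.exists_isFeedback_inner_sub hA hv
  rw [← map_sub, real_inner_comm, hinner, ← P.IUdual_self_eq_neg_inner hA hv]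
  exact hb.enorm_two_mul_le v

theorem OperatorMaps.enorm_two_mul_inner_le (hu : P.OperatorMaps t u (-p))
    (hA : ∀ u, P.A₁ u u = 0) :
    ‖2 * ⟪P.ι u, p⟫‖ₑ ≤ 2 * ∑ j, P.observationDensity j t u := by
  have hzero : BelongsToPivot P.ι ((-P.A₁ - P.IUdual) 0) 0 := fun v => by simp
  simpa using hu.enorm_two_mul_inner_sub_le hA hzero

theorem OperatorMaps.exists_hasDerivAt_norm_sub_orbit_sq [CompleteSpace H] {x : ℝ → V}
    (hu : P.OperatorMaps t (x t) (-p)) (hA : ∀ u, P.A₁ u u = 0) {S : C0Semigroup H}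
    (hS : Generates P.ι (-P.A₁ - P.IUdual) S) (hx : HasDerivAt (fun s => P.ι (x s)) p t)
    {z z' : H} (hz : S.GeneratorMaps z z') {a : ℝ} (hat : a < t) :
    ∃ d, HasDerivAt (fun s => ‖P.ι (x s) - S.toFun (s - a) z‖ ^ 2) d t ∧
      ENNReal.ofReal d ≤ ∑ j, P.observationDensity j t (x t) ∧
      ‖d‖ₑ ≤ 2 * ∑ j, P.observationDensity j t (x t)
        + 4 * ENNReal.ofReal (-⟪S.toFun (t - a) z', S.toFun (t - a) z⟫) := by
  obtain ⟨v, hv, hpivot⟩ := (hS _ _).1 (hz.apply (sub_nonneg.2 hat.le))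
  have horbit : HasDerivAt (fun s => S.toFun (s - a) z) (S.toFun (t - a) z') t :=
    (hz.hasDerivAt (sub_pos.2 hat)).comp_sub_const t a
  refine ⟨_, (hx.sub horbit).norm_sq, ?_⟩
  simp only [Pi.sub_apply, ← hv]
  exact ⟨hu.ofReal_two_mul_inner_sub_le hA hpivot, hu.enorm_two_mul_inner_sub_le hA hpivot⟩

end Comparison

section Observability

variable {P} [CompleteSpace H] [CompleteSpace V] [∀ j, OpensMeasurableSpace (X j)]
  {x₀ : H} {x : ℝ → V} {a b : ℝ}

theorem IsSolution.norm_sq_le_add_observation (hx : P.IsSolution x₀ x)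
    (hA : ∀ u, P.A₁ u u = 0) (ha : 0 ≤ a) (hab : a ≤ b) (hO : P.observation x a b ≠ ∞) :
    ‖P.ι (x a)‖ ^ 2 ≤ ‖P.ι (x b)‖ ^ 2 + 2 * (P.observation x a b).toReal := by
  obtain ⟨Z, hZ, x', -, hx'⟩ := hx.equation
  have hcont : ContinuousOn (fun t => P.ι (x t)) (Icc a b) :=
    hx.continuousOn.mono fun _ ht => ha.trans ht.1
  have hO2 : ∫⁻ t in Ioc a b, 2 * ∑ j, P.observationDensity j t (x t)
      = 2 * P.observation x a b := by
    rw [lintegral_const_mul' _ _ ENNReal.ofNat_ne_top,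
      ← P.observation_eq_lintegral hx.continuousOn ha]
  have hO2_ne_top : 2 * P.observation x a b ≠ ∞ := ENNReal.mul_ne_top ENNReal.ofNat_ne_top hO
  have hmain := ofReal_sub_le_lintegral_of_hasDerivAt_off_countable
    (φ := fun t => -‖P.ι (x t)‖ ^ 2) (Φ := fun t => 2 * ∑ j, P.observationDensity j t (x t))
    hab (hcont.norm.pow 2).neg hZ (fun t ht => ?_) (hO2 ▸ hO2_ne_top)
  · rw [hO2, ENNReal.ofReal_le_iff_le_toReal hO2_ne_top, ENNReal.toReal_mul,
      ENNReal.toReal_ofNat] at hmain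
    linarith
  · have ht0 : 0 < t := ha.trans_lt ht.1.1
    obtain ⟨hderiv, hmaps⟩ := hx' t ⟨ht0.le, ht.2⟩
    have hbound := enorm_neg (2 * ⟪P.ι (x t), x' t⟫) ▸ hmaps.enorm_two_mul_inner_le hA
    exact ⟨_, (hderiv.hasDerivAt (Ici_mem_nhds ht0)).norm_sq.neg,
      (Real.ofReal_le_enorm _).trans hbound, hbound⟩

variable {S : C0Semigroup H}

theorem IsSolution.norm_sub_orbit_sq_le_of_generatorMaps (hx : P.IsSolution x₀ x)
    (hA : ∀ u, P.A₁ u u = 0) (hS : Generates P.ι (-P.A₁ - P.IUdual) S) (ha : 0 ≤ a)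
    (hab : a ≤ b) (hO : P.observation x a b ≠ ∞) {z z' : H} (hz : S.GeneratorMaps z z') :
    ‖P.ι (x b) - S.toFun (b - a) z‖ ^ 2
      ≤ ‖P.ι (x a) - z‖ ^ 2 + (P.observation x a b).toReal := by
  obtain ⟨Z, hZ, x', -, hx'⟩ := hx.equation
  have hcont : ContinuousOn (fun t => P.ι (x t)) (Icc a b) :=
    hx.continuousOn.mono fun _ ht => ha.trans ht.1
  have horbit : ∀ ξ, ContinuousOn (fun t => S.toFun (t - a) ξ) (Icc a b) := fun ξ =>
    (S.continuousOn ξ).comp (by fun_prop) fun _ ht => sub_nonneg.2 ht.1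
  have hOint := P.observation_eq_lintegral hx.continuousOn ha (b := b)
  have hdissip : IntegrableOn (fun t => -⟪S.toFun (t - a) z', S.toFun (t - a) z⟫) (Ioc a b) :=
    (((horbit z').inner (horbit z)).neg.integrableOn_Icc).mono_set Ioc_subset_Icc_self
  have hmain := ofReal_sub_le_lintegral_of_hasDerivAt_off_countable
    (φ := fun t => ‖P.ι (x t) - S.toFun (t - a) z‖ ^ 2)
    (Φ := fun t => ∑ j, P.observationDensity j t (x t))
    (Ψ := fun t => 2 * ∑ j, P.observationDensity j t (x t)
      + 4 * ENNReal.ofReal (-⟪S.toFun (t - a) z', S.toFun (t - a) z⟫))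
    hab ((hcont.sub (horbit z)).norm.pow 2) hZ (fun t ht => ?_) ?_
  · rw [← hOint, ENNReal.ofReal_le_iff_le_toReal hO, sub_self, S.map_zero,
      ContinuousLinearMap.id_apply] at hmain
    linarith
  · have ht0 : 0 < t := ha.trans_lt ht.1.1
    obtain ⟨hderiv, hmaps⟩ := hx' t ⟨ht0.le, ht.2⟩
    exact hmaps.exists_hasDerivAt_norm_sub_orbit_sq hA hS (hderiv.hasDerivAt (Ici_mem_nhds ht0)) hz
      ht.1.1
  · rw [lintegral_add_right' _ (hdissip.1.aemeasurable.ennreal_ofReal.const_mul 4),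
      lintegral_const_mul' _ _ ENNReal.ofNat_ne_top, lintegral_const_mul' _ _ ENNReal.ofNat_ne_top,
      ← hOint]
    exact ENNReal.add_ne_top.2 ⟨ENNReal.mul_ne_top ENNReal.ofNat_ne_top hO,
      ENNReal.mul_ne_top ENNReal.ofNat_ne_top hdissip.lintegral_lt_top.ne⟩

theorem IsSolution.norm_sub_orbit_sq_le (hx : P.IsSolution x₀ x) (hA : ∀ u, P.A₁ u u = 0)
    (hS : Generates P.ι (-P.A₁ - P.IUdual) S) (ha : 0 ≤ a) (hab : a ≤ b)
    (hO : P.observation x a b ≠ ∞) (z : H) :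
    ‖P.ι (x b) - S.toFun (b - a) z‖ ^ 2
      ≤ ‖P.ι (x a) - z‖ ^ 2 + (P.observation x a b).toReal := by
  revert z
  refine isClosed_property S.dense_domain.denseRange_val
    (isClosed_le (by fun_prop) (by fun_prop)) ?_
  rintro ⟨z, z', hz⟩
  exact hx.norm_sub_orbit_sq_le_of_generatorMaps hA hS ha hab hO hz

theorem IsSolution.energy_le_observation (hx : P.IsSolution x₀ x) (hA : ∀ u, P.A₁ u u = 0)
    (hS : Generates P.ι (-P.A₁ - P.IUdual) S) (ha : 0 ≤ a) (hab : a ≤ b)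
    (hhalf : ∀ z, ‖S.toFun (b - a) z‖ ≤ 1 / 2 * ‖z‖) :
    ENNReal.ofReal (P.energy x b) ≤ ENNReal.ofReal 3 * P.observation x a b := by
  obtain hO | hO := eq_or_ne (P.observation x a b) ∞
  · rw [hO, ENNReal.mul_top (by simp)]
    exact le_top
  have hback := hx.norm_sq_le_add_observation hA ha hab hO
  have hdiff := hx.norm_sub_orbit_sq_le hA hS ha hab hO (P.ι (x a))
  rw [sub_self, norm_zero, zero_pow two_ne_zero, zero_add] at hdiff
  have htriangle : ‖P.ι (x b)‖
      ≤ 1 / 2 * ‖P.ι (x a)‖ + ‖P.ι (x b) - S.toFun (b - a) (P.ι (x a))‖ :=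
    (norm_le_insert' _ _).trans (by gcongr; exact hhalf _)
  have hsq : ‖P.ι (x b)‖ ^ 2 ≤ 1 / 2 * ‖P.ι (x a)‖ ^ 2 + 2 * (P.observation x a b).toReal := by
    nlinarith [sq_nonneg (1 / 2 * ‖P.ι (x a)‖ - ‖P.ι (x b) - S.toFun (b - a) (P.ι (x a))‖),
      norm_nonneg (P.ι (x b))]
  rw [← ENNReal.ofReal_toReal hO, ← ENNReal.ofReal_mul zero_le_three]
  refine ENNReal.ofReal_le_ofReal ?_
  rw [energy]
  linarith

end Observability

end DampedSystem

theorem exists_forall_mul_exp_neg_mul_le (C : ℝ) {ω ε : ℝ} (hω : 0 < ω) (hε : 0 < ε) :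
    ∃ T₀ : ℝ, 0 < T₀ ∧ ∀ T : ℝ, T₀ ≤ T → C * Real.exp (-ω * T) ≤ ε := by
  have hlim : Tendsto (fun T : ℝ => C * Real.exp (-(ω * T))) atTop (𝓝 (C * 0)) :=
    (Real.tendsto_exp_neg_atTop_nhds_zero.comp (tendsto_id.const_mul_atTop hω)).const_mul C
  rw [mul_zero] at hlim
  obtain ⟨T₁, hT₁⟩ := eventually_atTop.1 (hlim.eventually_le_const hε)
  refine ⟨max T₁ 1, by positivity, fun T hT => ?_⟩
  rw [neg_mul]
  exact hT₁ T ((le_max_left _ _).trans hT)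

theorem mainTheorem9_general (C ω : ℝ) (hω : 0 < ω) :
    ∃ T₀ : ℝ, 0 < T₀ ∧
      ∀ (H V : Type*) [NormedAddCommGroup H] [InnerProductSpace ℝ H] [CompleteSpace H]
        [NormedAddCommGroup V] [InnerProductSpace ℝ V] [CompleteSpace V]
        (J : ℕ) (N : Fin J → ℕ) (X : Fin J → Type*)
        [∀ j, MetricSpace (X j)] [∀ j, MeasurableSpace (X j)]
        [∀ j, OpensMeasurableSpace (X j)]
        (μ : ∀ j, Measure (X j)) (P : DampedSystem H V N X μ),
        (∀ u : V, P.A₁ u u = 0) →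
        ∀ S : C0Semigroup H, Generates P.ι (-P.A₁ - P.IUdual) S →
        (∀ t : ℝ, 0 ≤ t → ∀ x₀ : H, ‖S.toFun t x₀‖ ≤ C * Real.exp (-ω * t) * ‖x₀‖) →
        ∀ (x₀ : H) (x : ℝ → V), P.IsSolution x₀ x →
          ∀ a b : ℝ, 0 ≤ a → a + T₀ ≤ b →
            ENNReal.ofReal (P.energy x b) ≤ ENNReal.ofReal 3 * P.observation x a b := by
  obtain ⟨T₀, hT₀, hexp⟩ := exists_forall_mul_exp_neg_mul_le C hω (half_pos one_pos)
  refine ⟨T₀, hT₀, ?_⟩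
  intro H V _ _ _ _ _ _ J N X _ _ _ μ P hA S hS hdecay x₀ x hx a b ha hab
  have hT : T₀ ≤ b - a := le_sub_iff_add_le'.2 hab
  refine hx.energy_le_observation hA hS ha (by linarith) fun ξ =>
    (hdecay _ (hT₀.le.trans hT) ξ).trans ?_
  gcongr
  exact hexp _ hT

theorem mainTheorem9 (C ω : ℝ) (hC : 0 < C) (hω : 0 < ω) :
    ∃ T₀ : ℝ, 0 < T₀ ∧ ∀ T : ℝ, T₀ ≤ T → ∃ D : ℝ, 1 < D ∧
      ∀ (H V : Type*) [NormedAddCommGroup H] [InnerProductSpace ℝ H] [CompleteSpace H]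
        [NormedAddCommGroup V] [InnerProductSpace ℝ V] [CompleteSpace V]
        (J : ℕ) (N : Fin J → ℕ) (X : Fin J → Type*)
        [∀ j, MetricSpace (X j)] [∀ j, MeasurableSpace (X j)]
        [∀ j, OpensMeasurableSpace (X j)]
        (μ : ∀ j, Measure (X j)) [∀ j, IsFiniteMeasure (μ j)]
        (P : DampedSystem H V N X μ),
        (∀ u : V, P.A₁ u u = 0) →
        (∃ S : C0Semigroup H, S.IsContractive ∧ Generates P.ι (P.A₁ - P.IUdual) S) →
        (∃ S : C0Semigroup H, S.IsContractive ∧ Generates P.ι (-P.A₁ - P.IUdual) S ∧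
          ∀ t : ℝ, 0 ≤ t → ∀ x₀ : H, ‖S.toFun t x₀‖ ≤ C * Real.exp (-ω * t) * ‖x₀‖) →
        ∀ (x₀ : H) (x : ℝ → V), P.IsSolution x₀ x →
          ENNReal.ofReal (P.energy x T) ≤ ENNReal.ofReal D * P.observation x 0 T ∧
          ∀ n : ℕ, ENNReal.ofReal (P.energy x (((n : ℝ) + 1) * T)) ≤
            ENNReal.ofReal D * P.observation x ((n : ℝ) * T) (((n : ℝ) + 1) * T) := by
  obtain ⟨T₀, hT₀, h⟩ := mainTheorem9_general C ω hω
  refine ⟨T₀, hT₀, fun T hT => ⟨3, by norm_num, ?_⟩⟩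
  rintro H V _ _ _ _ _ _ J N X _ _ _ μ _ P hA - ⟨S, -, hS, hdecay⟩ x₀ x hx
  have hobs := h H V J N X μ P hA S hS hdecay x₀ x hx
  have hT0 : 0 ≤ T := hT₀.le.trans hT
  exact ⟨hobs 0 T le_rfl (by linarith), fun n => hobs _ _ (by positivity) (by linarith)⟩
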